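/- Let $n\ge 2$, let $\Delta=\{p\in\mathbb R^n: p_i>0 \text{ for all } i,\ \sum_{i=1}^n p_i=1\}$ be the open unit simplex, $\overline{\Delta}$ its closure, $e(1)=(1,0,\dots,0)$ and $\overline e=(\tfrac1n,\dots,\tfrac1n)$. A portfolio is a Borel measurable map $\pi:\Delta\to\overline{\Delta}$; for a sequence $\mu=\{\mu(t)\}_{t\ge 0}$ in $\Delta$ (a market weight sequence) its relative value process is given by $V_\pi(0)=1$ and $$\frac{V_\pi(t+1)}{V_\pi(t)}=1+\sum_{i=1}^n\frac{\pi_i(\mu(t))}{\mu_i(t)}\bigl(\mu_i(t+1)-\mu_i(t)\bigr),\qquad t\ge 0 .$$ Let $\Phi:\Delta\to(0,\infty)$ be a measure of diversity, that is, a concave, twice continuously differentiable function that is invariant under permutations of the coordinates, and let $\pi$ be a portfolio generated by $\Phi$, that is, $$1+\sum_{i=1}^n\frac{\pi_i(p)}{p_i}(q_i-p_i)\ \ge\ \frac{\Phi(q)}{\Phi(p)}\qquad\text{for all } p,q\in\Delta .$$ Assume that $$\int_0^1\frac{1}{\Phi\bigl(t\,e(1)+(1-t)\,\overline e\bigr)^2}\,dt=\infty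 .$$ Let $\tau:\Delta\to\overline{\Delta}$ be a continuously differentiable portfolio with $\tau\ne\pi$. Then there are a compact set $K\subset\Delta$ and a market weight sequence $\{\mu(t)\}_{t\ge0}$ taking values in $K$, which is periodic in $t$ (a finite cycle repeated forever), such that $$\lim_{t\to\infty}\frac{V_\tau(t)}{V_\pi(t)}=0 .$$ -/

import Mathlib

namespace PortfolioTheory

/-- The open unit simplex `Δ⁽ⁿ⁾` in `ℝⁿ`. Its closure in `ℝⁿ` is Mathlib's `stdSimplex ℝ (Fin n)`. -/
def openSimplex (n : ℕ) : Set (Fin n → ℝ) :=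
  {p | (∀ i, 0 < p i) ∧ ∑ i, p i = 1}

/-- The barycenter `(1/n, …, 1/n)`. -/
noncomputable def barycenter (n : ℕ) : Fin n → ℝ := fun _ => 1 / (n : ℝ)

/-- A portfolio: a Borel measurable map from the open simplex to the closed simplex. Maps are
represented by total functions on `ℝⁿ`, of which only the values on the open simplex matter. -/
structure IsPortfolio {n : ℕ} (π : (Fin n → ℝ) → (Fin n → ℝ)) : Prop where
  measurable : Measurable ((openSimplex n).domRestrict π)
  mapsTo : Set.MapsTo π (openSimplex n) (stdSimplex ℝ (Fin n))

/-- A map is `C¹` on the open simplex. The open simplex is relatively open in an affine hyperplane,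
so `ContDiffOn` (existence of a derivative along the set, depending continuously on the point) is
the usual notion: equivalently, the map is `C¹` in affine coordinates of the hyperplane. -/
def IsC1 {n : ℕ} (π : (Fin n → ℝ) → (Fin n → ℝ)) : Prop :=
  ContDiffOn ℝ 1 π (openSimplex n)

/-- The inner product `⟨π(p)/p, q - p⟩` of the weight ratio at `p` with the displacement to `q`. -/
noncomputable def excessReturn {n : ℕ} (π : (Fin n → ℝ) → (Fin n → ℝ)) (p q : Fin n → ℝ) : ℝ :=
  ∑ i, π p i / p i * (q i - p i)

/-- The relative value process `V_π(t)` along the market weight sequence `μ`. -/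
noncomputable def relativeValue {n : ℕ} (π : (Fin n → ℝ) → (Fin n → ℝ)) (μ : ℕ → Fin n → ℝ) :
    ℕ → ℝ
  | 0 => 1
  | t + 1 => relativeValue π μ t * (1 + excessReturn π (μ t) (μ (t + 1)))

/-- A measure of diversity: a positive concave `C²` function on the open simplex that is
invariant under permutations of the coordinates. -/
structure IsMeasureOfDiversity {n : ℕ} (Φ : (Fin n → ℝ) → ℝ) : Prop where
  pos : ∀ p ∈ openSimplex n, 0 < Φ p
  concave : ConcaveOn ℝ (openSimplex n) Φ
  contDiff : ContDiffOn ℝ 2 Φ (openSimplex n)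
  symm : ∀ p ∈ openSimplex n, ∀ σ : Equiv.Perm (Fin n), Φ (fun i => p (σ i)) = Φ p

/-- The portfolio `π` is generated by `Φ`. -/
def IsGeneratedBy {n : ℕ} (π : (Fin n → ℝ) → (Fin n → ℝ)) (Φ : (Fin n → ℝ) → ℝ) : Prop :=
  ∀ p ∈ openSimplex n, ∀ q ∈ openSimplex n, Φ q / Φ p ≤ 1 + excessReturn π p q

end PortfolioTheory

open PortfolioTheory Filter Topology MeasureTheory

namespace PortfolioTheory

/-! Two points suffice for the cycle. If no two-cycle makes `τ` lose to `π`, restrict to the line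
from a point `p` to a vertex. Let `a`, `b` be the returns of `τ`, `π` per unit of parameter and `g`
the restriction of `Φ`. Small two-cycles give `a' + a² ≤ b' + b²` (`add_sq_le_of_two_cycle`), and
generation gives `b = g'/g`. If `τ` held less than `π` of the asset of that vertex at `p`, then `a <
b` there, and this Riccati inequality would make `1/g²` integrable up to the vertex
(`integrableOn_one_div_sq_of_riccati`). By symmetry and concavity `g` is at most `Φ` on the central
line (`IsMeasureOfDiversity.le_average`), contradicting the divergent integral. So every weight of
`τ` dominates that of `π`; both sum to one, hence they agree. -/

/-! ### Values along a repeated two-cycle -/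

lemma one_add_excessReturn {n : ℕ} {τ : (Fin n → ℝ) → (Fin n → ℝ)}
    (hτ : Set.MapsTo τ (openSimplex n) (stdSimplex ℝ (Fin n)))
    {p : Fin n → ℝ} (hp : p ∈ openSimplex n) (q : Fin n → ℝ) :
    1 + excessReturn τ p q = ∑ i, τ p i / p i * q i := by
  have h : ∀ i, τ p i / p i * (q i - p i) = τ p i / p i * q i - τ p i := fun i => by
    have := (hp.1 i).ne'
    field_simp
  simp only [excessReturn, h, Finset.sum_sub_distrib, (hτ hp).2]
  ring

lemma one_add_excessReturn_nonneg {n : ℕ} {τ : (Fin n → ℝ) → (Fin n → ℝ)}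
    (hτ : Set.MapsTo τ (openSimplex n) (stdSimplex ℝ (Fin n)))
    {p q : Fin n → ℝ} (hp : p ∈ openSimplex n) (hq : q ∈ openSimplex n) :
    0 ≤ 1 + excessReturn τ p q := by
  rw [one_add_excessReturn hτ hp]
  exact Finset.sum_nonneg fun i _ =>
    mul_nonneg (div_nonneg ((hτ hp).1 i) (hp.1 i).le) (hq.1 i).le

lemma tendsto_zero_of_add_two_eq_mul {R : ℕ → ℝ} {r : ℝ} (hr0 : 0 ≤ r) (hr1 : r < 1)
    (h : ∀ t, R (t + 2) = r * R t) : Tendsto R atTop (𝓝 0) := by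
  have hpow : ∀ c k, R (2 * k + c) = r ^ k * R c := by
    intro c k
    induction k with
    | zero => simp
    | succ k ih =>
      rw [show 2 * (k + 1) + c = 2 * k + c + 2 by ring, h, ih]
      ring
  have hlim : ∀ c, Tendsto (fun k => R (2 * k + c)) atTop (𝓝 0) := fun c => by
    simpa [hpow] using (tendsto_pow_atTop_nhds_zero_of_lt_one hr0 hr1).mul_const (R c)
  rw [Metric.tendsto_atTop]
  intro ε hε
  obtain ⟨N₀, h₀⟩ := Metric.tendsto_atTop.1 (hlim 0) ε hε
  obtain ⟨N₁, h₁⟩ := Metric.tendsto_atTop.1 (hlim 1) ε hε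
  refine ⟨2 * (N₀ + N₁) + 1, fun t ht => ?_⟩
  rcases Nat.even_or_odd' t with ⟨k, rfl | rfl⟩
  · exact h₀ k (by omega)
  · exact h₁ k (by omega)

/-- A two-cycle on which `τ` gains less than `π`, repeated forever, drives the value of `τ`
relative to `π` to zero. -/
lemma exists_periodic_of_two_cycle {n : ℕ} {π τ : (Fin n → ℝ) → (Fin n → ℝ)}
    {p q : Fin n → ℝ} (hp : p ∈ openSimplex n) (hq : q ∈ openSimplex n)
    (hτ0 : 0 ≤ (1 + excessReturn τ p q) * (1 + excessReturn τ q p))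
    (hlt : (1 + excessReturn τ p q) * (1 + excessReturn τ q p) <
      (1 + excessReturn π p q) * (1 + excessReturn π q p)) :
    ∃ K : Set (Fin n → ℝ), IsCompact K ∧ K ⊆ openSimplex n ∧
      ∃ μ : ℕ → Fin n → ℝ, (∀ t, μ t ∈ K) ∧ (∃ N : ℕ, 0 < N ∧ ∀ t, μ (t + N) = μ t) ∧
        Tendsto (fun t => relativeValue τ μ t / relativeValue π μ t) atTop (𝓝 0) := by
  refine ⟨{p, q}, (Set.toFinite _).isCompact, by simp [Set.insert_subset_iff, hp, hq],
    fun t => if Even t then p else q, fun t => ?_, ⟨2, two_pos, fun t => ?_⟩, ?_⟩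
  · dsimp only
    split_ifs <;> simp
  · simp [Nat.even_add]
  · have hπ0 := hτ0.trans_lt hlt
    refine tendsto_zero_of_add_two_eq_mul (div_nonneg hτ0 hπ0.le)
      ((div_lt_one hπ0).2 hlt) fun t => ?_
    simp only [relativeValue]
    rw [div_mul_div_comm]
    rcases Nat.even_or_odd t with ht | ht
    · have h1 : ¬ Even (t + 1) := by simpa [Nat.even_add_one] using ht
      have h2 : Even (t + 1 + 1) := by simpa [Nat.even_add_one] using ht
      simp only [ht, h1, h2, if_true, if_false]
      ring_nf
    · rw [← Nat.not_even_iff_odd] at ht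
      have h1 : Even (t + 1) := by simpa [Nat.even_add_one] using ht
      have h2 : ¬ Even (t + 1 + 1) := by simpa [Nat.even_add_one] using ht
      simp only [ht, h1, h2, if_true, if_false]
      ring_nf

/-! ### Riccati inequality on an interval -/

/-- The gain of a cycle between `s` and `t` differs from `1` only at order `(t - s)²`, with limiting
coefficient `-(c' + c²)`. -/
lemma add_sq_le_of_two_cycle {a b : ℝ → ℝ} {a' b' s : ℝ} (ha : HasDerivAt a a' s)
    (hb : HasDerivAt b b' s)
    (h : ∀ᶠ t in 𝓝[>] s, (1 + b s * (t - s)) * (1 + b t * (s - t)) ≤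
      (1 + a s * (t - s)) * (1 + a t * (s - t))) :
    a' + a s ^ 2 ≤ b' + b s ^ 2 := by
  have lim : ∀ {c : ℝ → ℝ} {c' : ℝ}, HasDerivAt c c' s →
      Tendsto (fun t => slope c s t + c s * c t) (𝓝[>] s) (𝓝 (c' + c s ^ 2)) := by
    intro c c' hc
    have h1 : Tendsto (slope c s) (𝓝[>] s) (𝓝 c') :=
      (hasDerivAt_iff_tendsto_slope.1 hc).mono_left
        (nhdsWithin_mono _ fun x hx => ne_of_gt hx)
    have h2 : Tendsto c (𝓝[>] s) (𝓝 (c s)) := hc.continuousAt.mono_left nhdsWithin_le_nhds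
    rw [sq]
    exact h1.add (h2.const_mul _)
  refine le_of_tendsto_of_tendsto (lim ha) (lim hb) ?_
  filter_upwards [h, self_mem_nhdsWithin] with t ht hts
  have hpos : 0 < t - s := sub_pos.2 hts
  have key : ∀ c : ℝ → ℝ, (1 + c s * (t - s)) * (1 + c t * (s - t)) =
      1 - (t - s) ^ 2 * (slope c s t + c s * c t) := by
    intro c
    rw [slope_def_field]
    field_simp
    ring
  rw [key, key] at ht
  exact le_of_mul_le_mul_left (by linarith) (pow_pos hpos 2)

/-- Riccati comparison: if `a' + a² ≤ b' + b²` with `b = g'/g`, and `a < b` at some point, then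
`1/g²` is integrable up to the right end point. -/
lemma integrableOn_one_div_sq_of_riccati {a b a' b' g : ℝ → ℝ} {l s e : ℝ}
    (hls : l < s) (hg : ∀ t ∈ Set.Ioo l e, 0 < g t)
    (hg' : ∀ t ∈ Set.Ioo l e, HasDerivAt g (g t * b t) t)
    (ha : ∀ t ∈ Set.Ioo l e, HasDerivAt a (a' t) t)
    (hb : ∀ t ∈ Set.Ioo l e, HasDerivAt b (b' t) t)
    (hab : ∀ t ∈ Set.Ioo l e, a' t + a t ^ 2 ≤ b' t + b t ^ 2)
    (hs : a s < b s) (hse : s < e) {T : ℝ} (hsT : s ≤ T) (hTe : T < e) :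
    IntegrableOn (fun t => 1 / g t ^ 2) (Set.Ioc T e) := by
  -- As `(a - b)' ≤ -(a - b)² - 2b(a - b)`, the integrating factor `g²` removes the linear term and
  -- leaves `w' ≤ -w²/g²`.
  set w : ℝ → ℝ := fun t => g t ^ 2 * (a t - b t) with hw
  set w' : ℝ → ℝ := fun t => g t ^ 2 * (a' t - b' t + 2 * b t * (a t - b t)) with hw'
  have hwd : ∀ t ∈ Set.Ioo l e, HasDerivAt w (w' t) t := by
    intro t ht
    refine (((hg' t ht).pow 2).mul ((ha t ht).sub (hb t ht))).congr_deriv ?_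
    simp [hw']
    ring
  have hw'le : ∀ t ∈ Set.Ioo l e, w' t * g t ^ 2 ≤ -(w t) ^ 2 := by
    intro t ht
    have h1 : a' t - b' t + 2 * b t * (a t - b t) ≤ -(a t - b t) ^ 2 := by
      nlinarith [hab t ht]
    have h2 : 0 ≤ g t ^ 4 := by positivity
    have := mul_le_mul_of_nonneg_left h1 h2
    simp only [hw, hw']
    linear_combination this
  have hsub : Set.Ico s e ⊆ Set.Ioo l e := fun t ht => ⟨hls.trans_le ht.1, ht.2⟩
  have hanti : AntitoneOn w (Set.Ico s e) := by
    refine antitoneOn_of_deriv_nonpos (convex_Ico _ _)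
      (fun t ht => (hwd t (hsub ht)).continuousAt.continuousWithinAt)
      (fun t ht => ?_) (fun t ht => ?_) <;>
    have ht' := hsub (interior_subset ht)
    · exact (hwd t ht').differentiableAt.differentiableWithinAt
    · rw [(hwd t ht').deriv]
      have := hw'le t ht'
      have hgt := pow_pos (hg t ht') 2
      by_contra! hc
      nlinarith [mul_pos hc hgt, sq_nonneg (w t)]
  have hws : w s < 0 :=
    mul_neg_of_pos_of_neg (pow_pos (hg s (hsub ⟨le_rfl, hse⟩)) 2) (sub_neg.2 hs)
  have hwneg : ∀ t ∈ Set.Ico s e, w t < 0 := fun t ht =>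
    (hanti ⟨le_rfl, hse⟩ ht ht.1).trans_lt hws
  have hcont : ContinuousOn (fun t => 1 / g t ^ 2) (Set.Ico s e) := fun t ht =>
    (continuousAt_const.div ((hg' t (hsub ht)).continuousAt.pow 2)
      (pow_pos (hg t (hsub ht)) 2).ne').continuousWithinAt
  have hTS : ∀ {S}, S < e → Set.Icc T S ⊆ Set.Ico s e := fun hS t ht =>
    ⟨hsT.trans ht.1, ht.2.trans_lt hS⟩
  have hint : ∀ S < e, IntegrableOn (fun t => 1 / g t ^ 2) (Set.Icc T S) := fun S hS =>
    (hcont.mono (hTS hS)).integrableOn_compact isCompact_Icc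
  obtain ⟨u, -, hu, hulim⟩ := exists_seq_strictMono_tendsto' hTe
  -- `1/w` has derivative at least `1/g²` but stays negative, so it can rise by at most `-1/w(T)`.
  refine integrableOn_Ioc_of_intervalIntegral_norm_bounded_right (I := -(w T)⁻¹) (l := atTop)
    (b := u) (fun i => (hint _ (hu i).2).mono_set Set.Ioc_subset_Icc_self) hulim
    (Eventually.of_forall fun i => ?_)
  have hTu := (hu i).1.le
  have hnorm : ∀ t, ‖1 / g t ^ 2‖ = 1 / g t ^ 2 := fun t => by
    rw [Real.norm_of_nonneg (by positivity)]
  simp only [hnorm]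
  rw [← intervalIntegral.integral_of_le hTu]
  have hd : ∀ t ∈ Set.Icc T (u i), HasDerivAt (fun t => (w t)⁻¹) (-w' t / w t ^ 2) t :=
    fun t ht => (hwd t (hsub (hTS (hu i).2 ht))).inv (hwneg t (hTS (hu i).2 ht)).ne
  have hle := intervalIntegral.integral_le_sub_of_hasDeriv_right_of_le
    (g := fun t => (w t)⁻¹) (g' := fun t => -w' t / w t ^ 2) (φ := fun t => 1 / g t ^ 2) hTu
    (fun t ht => (hd t ht).continuousAt.continuousWithinAt)
    (fun t ht => (hd t (Set.Ioo_subset_Icc_self ht)).hasDerivWithinAt)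
    (hint _ (hu i).2) (fun t ht => ?_)
  · have hneg : (w (u i))⁻¹ < 0 := inv_lt_zero.2 (hwneg _ ⟨hsT.trans hTu, (hu i).2⟩)
    linarith
  · have ht' := hTS (hu i).2 (Set.Ioo_subset_Icc_self ht)
    rw [div_le_div_iff₀ (pow_pos (hg t (hsub ht')) 2) (sq_pos_of_neg (hwneg t ht'))]
    linarith [hw'le t (hsub ht')]

/-! ### Symmetrization -/

lemma comp_perm_mem_openSimplex {n : ℕ} {q : Fin n → ℝ} (hq : q ∈ openSimplex n)
    (σ : Equiv.Perm (Fin n)) : (fun j => q (σ j)) ∈ openSimplex n :=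
  ⟨fun _ => hq.1 _, (Equiv.sum_comp σ q).trans hq.2⟩

/-- Averaging over all the permutations that move coordinate `i` to place `k` increases a measure
of diversity. -/
lemma IsMeasureOfDiversity.le_average {n : ℕ} {Φ : (Fin n → ℝ) → ℝ}
    (hΦ : IsMeasureOfDiversity Φ) {q : Fin n → ℝ} (hq : q ∈ openSimplex n) (i k : Fin n) :
    Φ q ≤ Φ (fun j => if j = k then q i else (1 - q i) / ((n : ℝ) - 1)) := by
  classical
  set S : Finset (Equiv.Perm (Fin n)) := Finset.univ.filter fun σ => σ k = i with hS
  have hSne : (S.card : ℝ) ≠ 0 := by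
    have : (Equiv.swap k i) ∈ S := by simp [hS]
    exact_mod_cast (Finset.card_pos.2 ⟨_, this⟩).ne'
  have hw : ∑ _σ ∈ S, (S.card : ℝ)⁻¹ = 1 := by simp [hSne]
  have hle := hΦ.concave.le_map_sum (t := S) (w := fun _ => (S.card : ℝ)⁻¹)
    (p := fun σ j => q (σ j)) (fun _ _ => by positivity) hw
    (fun σ _ => comp_perm_mem_openSimplex hq σ)
  simp only [hΦ.symm q hq, smul_eq_mul] at hle
  rw [← Finset.sum_mul, hw, one_mul] at hle
  set A : Fin n → ℝ := ∑ σ ∈ S, (S.card : ℝ)⁻¹ • (fun j => q (σ j)) with hA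
  have hAj : ∀ j, A j = ∑ σ ∈ S, (S.card : ℝ)⁻¹ * q (σ j) := fun j => by
    simp [hA, Finset.sum_apply]
  have hAk : A k = q i := by
    rw [hAj, ← one_mul (q i), ← hw, Finset.sum_mul]
    exact Finset.sum_congr rfl fun σ hσ => by rw [(Finset.mem_filter.1 hσ).2]
  -- Composing with the swap of `j` and `l` permutes `S`, since it fixes `k`.
  have hAeq : ∀ j l, j ≠ k → l ≠ k → A j = A l := by
    intro j l hj hl
    rw [hAj, hAj]
    refine Finset.sum_nbij' (fun σ => σ * Equiv.swap j l) (fun σ => σ * Equiv.swap j l)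
      ?_ ?_ ?_ ?_ ?_
    · intro σ hσ
      simpa [hS, Equiv.swap_apply_of_ne_of_ne hj.symm hl.symm] using hσ
    · intro σ hσ
      simpa [hS, Equiv.swap_apply_of_ne_of_ne hj.symm hl.symm] using hσ
    · intro σ _
      simp [mul_assoc]
    · intro σ _
      simp [mul_assoc]
    · intro σ _
      simp
  have hAsum : ∑ j, A j = 1 := by
    simp only [hAj]
    rw [Finset.sum_comm, ← hw]
    refine Finset.sum_congr rfl fun σ _ => ?_
    rw [← Finset.mul_sum, Equiv.sum_comp σ q, hq.2, mul_one]
  refine hle.trans_eq (congrArg Φ (funext fun j => Eq.symm ?_))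
  split_ifs with hj
  · rw [hj, hAk]
  · have h1 : ∑ l ∈ Finset.univ.erase k, A l = ((n : ℝ) - 1) * A j := by
      rw [Finset.sum_congr rfl fun l hl => hAeq l j (Finset.ne_of_mem_erase hl) hj,
        Finset.sum_const, Finset.card_erase_of_mem (Finset.mem_univ k), Finset.card_univ,
        Fintype.card_fin, nsmul_eq_mul, Nat.cast_pred (Fin.pos k)]
    have hn : (n : ℝ) - 1 ≠ 0 := by
      have : 1 < n := by
        have := j.2
        have := k.2
        have := Fin.val_ne_of_ne hj
        omega
      have : (1 : ℝ) < n := by exact_mod_cast this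
      linarith
    rw [← Finset.add_sum_erase _ _ (Finset.mem_univ k), hAk, h1] at hAsum
    rw [div_eq_iff hn]
    linarith

/-! ### Lines into a vertex -/

/-- The line through the vertex `e(i)` (at parameter `1`) with velocity `v`. -/
def vertexLine {n : ℕ} (i : Fin n) (v : Fin n → ℝ) (t : ℝ) : Fin n → ℝ :=
  fun j => (Pi.single i 1 : Fin n → ℝ) j - (1 - t) * v j

lemma vertexLine_mem {n : ℕ} {i : Fin n} {v : Fin n → ℝ} (hsum : ∑ j, v j = 0)
    (hi : 0 < v i) (hneg : ∀ j, j ≠ i → v j < 0) {t : ℝ} (ht : t ∈ Set.Ioo (1 - 1 / v i) 1) :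
    vertexLine i v t ∈ openSimplex n := by
  have h1 : 0 < 1 - t := sub_pos.2 ht.2
  refine ⟨fun j => ?_, ?_⟩
  · by_cases hj : j = i
    · subst hj
      have : (1 - t) * v j < 1 := by
        rw [← lt_div_iff₀ hi]
        linarith [ht.1]
      simpa [vertexLine] using this
    · have := mul_neg_of_pos_of_neg h1 (hneg j hj)
      simpa [vertexLine, hj] using this
  · simp [vertexLine, Finset.sum_sub_distrib, ← Finset.mul_sum, hsum]

lemma contDiff_vertexLine {n : ℕ} (i : Fin n) (v : Fin n → ℝ) {m : WithTop ℕ∞} :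
    ContDiff ℝ m (vertexLine i v) := by
  unfold vertexLine
  fun_prop

lemma excessReturn_vertexLine {n : ℕ} (τ : (Fin n → ℝ) → (Fin n → ℝ)) (i : Fin n)
    (v : Fin n → ℝ) (s t : ℝ) :
    excessReturn τ (vertexLine i v s) (vertexLine i v t) =
      (∑ j, τ (vertexLine i v s) j / vertexLine i v s j * v j) * (t - s) := by
  rw [excessReturn, Finset.sum_mul]
  refine Finset.sum_congr rfl fun j _ => ?_
  rw [mul_assoc]
  congr 1
  simp only [vertexLine]
  ring

/-- A generated portfolio is the logarithmic gradient of its generating function along a line. -/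
lemma IsGeneratedBy.hasDerivAt_vertexLine {n : ℕ} {π : (Fin n → ℝ) → (Fin n → ℝ)}
    {Φ : (Fin n → ℝ) → ℝ} (hgen : IsGeneratedBy π Φ) (hΦ : ∀ p ∈ openSimplex n, 0 < Φ p)
    {i : Fin n} {v : Fin n → ℝ} {s : ℝ} (hs : ∀ᶠ t in 𝓝 s, vertexLine i v t ∈ openSimplex n)
    (hd : DifferentiableAt ℝ (fun t => Φ (vertexLine i v t)) s) :
    HasDerivAt (fun t => Φ (vertexLine i v t)) (Φ (vertexLine i v s) *
      ∑ j, π (vertexLine i v s) j / vertexLine i v s j * v j) s := by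
  set b := ∑ j, π (vertexLine i v s) j / vertexLine i v s j * v j with hb
  have hmem := hs.self_of_nhds
  have hpos := hΦ _ hmem
  -- Generation says that this affine function supports `Φ` from above at `s`.
  have hmax : IsLocalMax (fun t => Φ (vertexLine i v t) - Φ (vertexLine i v s) * b * (t - s)) s := by
    filter_upwards [hs] with t ht
    have := hgen _ hmem _ ht
    rw [excessReturn_vertexLine, div_le_iff₀ hpos, ← hb] at this
    linarith
  have hlin : HasDerivAt (fun t => Φ (vertexLine i v s) * b * (t - s))
      (Φ (vertexLine i v s) * b) s := by
    simpa using ((hasDerivAt_id s).sub_const s).const_mul (Φ (vertexLine i v s) * b)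
  have hzero := hmax.hasDerivAt_eq_zero (hd.hasDerivAt.sub hlin)
  rw [← sub_eq_zero.1 hzero]
  exact hd.hasDerivAt

/-! ### Comparison of the weights -/

/-- If a `C¹` portfolio never loses to the generated portfolio on two-cycles, then none of its
weights is smaller, because `1/Φ²` is not integrable towards the vertices. -/
lemma weight_le_of_two_cycle {n : ℕ} (hn : 2 ≤ n)
    {π τ : (Fin n → ℝ) → (Fin n → ℝ)} {Φ : (Fin n → ℝ) → ℝ}
    (hπ : Set.MapsTo π (openSimplex n) (stdSimplex ℝ (Fin n)))
    (hΦ : IsMeasureOfDiversity Φ) (hgen : IsGeneratedBy π Φ) (k : Fin n)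
    (hint : ∫⁻ t in Set.Ico (0 : ℝ) 1, ENNReal.ofReal
      (1 / Φ (t • Pi.single k (1 : ℝ) + (1 - t) • barycenter n) ^ 2) = ⊤)
    (hτ : Set.MapsTo τ (openSimplex n) (stdSimplex ℝ (Fin n))) (hτ1 : IsC1 τ)
    (hcycle : ∀ p ∈ openSimplex n, ∀ q ∈ openSimplex n,
      (1 + excessReturn π p q) * (1 + excessReturn π q p) ≤
        (1 + excessReturn τ p q) * (1 + excessReturn τ q p))
    {p : Fin n → ℝ} (hp : p ∈ openSimplex n) (i : Fin n) : π p i ≤ τ p i := by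
  by_contra! hlt
  have hn' : (2 : ℝ) ≤ n := by exact_mod_cast hn
  have hκ : 0 < 1 - 1 / (n : ℝ) := by
    rw [sub_pos, div_lt_one (by linarith)]
    linarith
  have hpi : p i < 1 := by
    obtain ⟨j, hj⟩ : ∃ j, j ≠ i := by
      have : Nontrivial (Fin n) := Fin.nontrivial_iff_two_le.2 hn
      exact exists_ne i
    have := Finset.add_le_sum (f := p) (s := Finset.univ) (fun j _ => (hp.1 j).le)
      (Finset.mem_univ i) (Finset.mem_univ j) hj.symm
    linarith [hp.1 j, hp.2]
  -- This scaling gives `v i = 1 - 1/n`, the speed of the central line, so averaging the point at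
  -- `t` lands exactly on the central point at `t`.
  set c : ℝ := (1 - p i) / (1 - 1 / (n : ℝ)) with hc
  have hc0 : 0 < c := div_pos (by linarith) hκ
  set v : Fin n → ℝ := fun j => ((Pi.single i 1 : Fin n → ℝ) j - p j) / c with hv
  have hvi : v i = 1 - 1 / (n : ℝ) := by
    have : 1 - p i ≠ 0 := by linarith
    simp only [hv, hc, Pi.single_eq_same]
    field_simp
  have hvj : ∀ j, j ≠ i → v j < 0 := fun j hj => by
    simpa [hv, hj] using div_neg_of_neg_of_pos (neg_neg_of_pos (hp.1 j)) hc0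
  have hvsum : ∑ j, v j = 0 := by
    simp [hv, ← Finset.sum_div, Finset.sum_sub_distrib, hp.2]
  -- The parameter at which coordinate `i` vanishes.
  set l : ℝ := 1 - 1 / v i with hl
  have hmem : ∀ t ∈ Set.Ioo l 1, vertexLine i v t ∈ openSimplex n := fun t ht =>
    vertexLine_mem hvsum (hvi ▸ hκ) hvj ht
  have hbase : vertexLine i v (1 - c) = p := by
    funext j
    simp only [vertexLine, hv]
    field_simp
    ring
  have hlc : l < 1 - c := by
    have : c < 1 / v i := by
      rw [hc, hvi]
      exact div_lt_div_of_pos_right (by linarith [hp.1 i]) hκ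
    linarith
  set ret : ((Fin n → ℝ) → (Fin n → ℝ)) → ℝ → ℝ := fun ρ t =>
    ∑ j, ρ (vertexLine i v t) j / vertexLine i v t j * v j with hret
  have hret_base : ∀ ρ, Set.MapsTo ρ (openSimplex n) (stdSimplex ℝ (Fin n)) →
      ret ρ (1 - c) = (ρ p i / p i - 1) / c := by
    intro ρ hρ
    have h : ∀ j, ρ p j / p j * v j = (ρ p j / p j * (Pi.single i 1 : Fin n → ℝ) j - ρ p j) / c :=
      fun j => by
        have := (hp.1 j).ne'
        simp only [hv]
        field_simp
    simp only [hret, hbase, h, ← Finset.sum_div, Finset.sum_sub_distrib, (hρ hp).2]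
    simp [Pi.single_apply]
  have hnhds : ∀ t ∈ Set.Ioo l 1, Set.Ioo l 1 ∈ 𝓝 t := fun t ht => isOpen_Ioo.mem_nhds ht
  have hgC : ContDiffOn ℝ 2 (fun t => Φ (vertexLine i v t)) (Set.Ioo l 1) :=
    hΦ.contDiff.comp (contDiff_vertexLine i v).contDiffOn hmem
  have hg' : ∀ t ∈ Set.Ioo l 1, HasDerivAt (fun t => Φ (vertexLine i v t))
      (Φ (vertexLine i v t) * ret π t) t := fun t ht =>
    hgen.hasDerivAt_vertexLine hΦ.pos (eventually_of_mem (hnhds t ht) hmem)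
      ((hgC.contDiffAt (hnhds t ht)).differentiableAt (by norm_num))
  -- No smoothness of `π` is assumed; it comes from `ret π = g'/g` with `g` of class `C²`.
  have hb : ∀ t ∈ Set.Ioo l 1, DifferentiableAt ℝ (ret π) t := by
    intro t ht
    have hd : DifferentiableAt ℝ (deriv fun t => Φ (vertexLine i v t)) t :=
      ((hgC.deriv_of_isOpen isOpen_Ioo (m := 1) (by norm_num)).contDiffAt
        (hnhds t ht)).differentiableAt (by norm_num)
    refine (hd.div (hg' t ht).differentiableAt (hΦ.pos _ (hmem t ht)).ne').congr_of_eventuallyEq ?_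
    filter_upwards [hnhds t ht] with u hu
    have := (hΦ.pos _ (hmem u hu)).ne'
    simp only [Pi.div_apply, (hg' u hu).deriv]
    field_simp
  have ha : ∀ t ∈ Set.Ioo l 1, DifferentiableAt ℝ (ret τ) t := by
    intro t ht
    have hline : DifferentiableAt ℝ (vertexLine i v) t :=
      ((contDiff_vertexLine i v (m := 1)).differentiable (by norm_num)) t
    have hd : DifferentiableAt ℝ (fun t => τ (vertexLine i v t)) t :=
      ((hτ1.comp (contDiff_vertexLine i v).contDiffOn hmem).contDiffAt
        (hnhds t ht)).differentiableAt (by norm_num)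
    refine DifferentiableAt.fun_sum fun j _ => ?_
    exact (((differentiableAt_pi.1 hd j).div (differentiableAt_pi.1 hline j)
      ((hmem t ht).1 j).ne').mul_const _)
  have hriccati : ∀ t ∈ Set.Ioo l 1,
      deriv (ret τ) t + ret τ t ^ 2 ≤ deriv (ret π) t + ret π t ^ 2 := by
    intro t ht
    refine add_sq_le_of_two_cycle (ha t ht).hasDerivAt (hb t ht).hasDerivAt ?_
    filter_upwards [mem_nhdsWithin_of_mem_nhds (hnhds t ht)] with u hu
    have := hcycle _ (hmem t ht) _ (hmem u hu)
    simpa only [excessReturn_vertexLine] using this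
  have hlt' : ret τ (1 - c) < ret π (1 - c) := by
    rw [hret_base τ hτ, hret_base π hπ]
    have := div_lt_div_of_pos_right hlt (hp.1 i)
    exact div_lt_div_of_pos_right (by linarith) hc0
  -- `1 - c` may be negative, while the central line is only used on `[0, 1)`.
  set T : ℝ := max (1 - c) 0 with hT
  have hT1 : T < 1 := max_lt (by linarith) one_pos
  have hfin : IntegrableOn (fun t => 1 / Φ (vertexLine i v t) ^ 2) (Set.Ioc T 1) :=
    integrableOn_one_div_sq_of_riccati hlc (fun t ht => hΦ.pos _ (hmem t ht)) hg'
      (fun t ht => (ha t ht).hasDerivAt) (fun t ht => (hb t ht).hasDerivAt) hriccati hlt'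
      (by linarith) (le_max_left _ _) hT1
  set F : ℝ → ℝ := fun t => Φ (t • Pi.single k (1 : ℝ) + (1 - t) • barycenter n) with hF
  have hcentral : ∀ t ∈ Set.Ico (0 : ℝ) 1,
      t • Pi.single k (1 : ℝ) + (1 - t) • barycenter n ∈ openSimplex n := by
    intro t ht
    refine ⟨fun j => ?_, ?_⟩
    · have h1 : 0 ≤ t * (Pi.single k (1 : ℝ) : Fin n → ℝ) j :=
        mul_nonneg ht.1 (by by_cases hj : j = k <;> simp [hj])
      have h2 : 0 < (1 - t) * (1 / (n : ℝ)) :=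
        mul_pos (by linarith [ht.2]) (by positivity)
      simpa [barycenter] using add_pos_of_nonneg_of_pos h1 (by simpa using h2)
    · have : (n : ℝ) ≠ 0 := by linarith
      simp [barycenter, Finset.sum_add_distrib, ← Finset.mul_sum]
      field_simp
      ring
  have hFcont : ContinuousOn (fun t => 1 / F t ^ 2) (Set.Ico (0 : ℝ) 1) := by
    refine continuousOn_const.div (ContinuousOn.pow ?_ 2)
      fun t ht => (pow_pos (hΦ.pos _ (hcentral t ht)) 2).ne'
    refine hΦ.contDiff.continuousOn.comp (Continuous.continuousOn ?_) hcentral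
    fun_prop
  have hle : ∀ t ∈ Set.Ioo l 1, Φ (vertexLine i v t) ≤ F t := by
    intro t ht
    refine (hΦ.le_average (hmem t ht) i k).trans_eq (congrArg Φ (funext fun j => ?_))
    have hn0 : (n : ℝ) ≠ 0 := by linarith
    have hn1 : (n : ℝ) - 1 ≠ 0 := by linarith
    by_cases hj : j = k
    · subst hj
      simp [vertexLine, barycenter, hvi]
      ring
    · simp [vertexLine, barycenter, hvi, hj]
      field_simp
  have hI1 : IntegrableOn (fun t => 1 / F t ^ 2) (Set.Icc 0 T) :=
    (hFcont.mono fun t ht => ⟨ht.1, ht.2.trans_lt hT1⟩).integrableOn_compact isCompact_Icc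
  have hI2 : IntegrableOn (fun t => 1 / F t ^ 2) (Set.Ioo T 1) := by
    refine (hfin.mono_set Set.Ioo_subset_Ioc_self).mono'
      ((hFcont.mono fun t ht => ⟨(le_max_right _ _).trans ht.1.le, ht.2⟩).aestronglyMeasurable
        measurableSet_Ioo) ?_
    filter_upwards [ae_restrict_mem measurableSet_Ioo] with t ht
    have ht' : t ∈ Set.Ioo l 1 := ⟨hlc.trans ((le_max_left _ _).trans_lt ht.1), ht.2⟩
    have hpos := hΦ.pos _ (hmem t ht')
    rw [Real.norm_of_nonneg (by positivity)]
    exact one_div_le_one_div_of_le (pow_pos hpos 2) (pow_le_pow_left₀ hpos.le (hle t ht') 2)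
  have hI : IntegrableOn (fun t => 1 / F t ^ 2) (Set.Ico 0 1) := by
    refine (hI1.union hI2).mono_set fun t ht => ?_
    rcases le_or_gt t T with h | h
    · exact Or.inl ⟨ht.1, h⟩
    · exact Or.inr ⟨h, ht.2⟩
  exact hI.lintegral_lt_top.ne hint

end PortfolioTheory

theorem corollary1p2 (n : ℕ) (hn : 2 ≤ n)
    (π τ : (Fin n → ℝ) → (Fin n → ℝ)) (Φ : (Fin n → ℝ) → ℝ)
    (hπ : PortfolioTheory.IsPortfolio π)
    (hΦ : PortfolioTheory.IsMeasureOfDiversity Φ)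
    (hgen : PortfolioTheory.IsGeneratedBy π Φ)
    (hint : ∫⁻ t in Set.Ico (0 : ℝ) 1, ENNReal.ofReal
      (1 / Φ (t • Pi.single (⟨0, by omega⟩ : Fin n) (1 : ℝ)
        + (1 - t) • PortfolioTheory.barycenter n) ^ 2) = ⊤)
    (hτ : PortfolioTheory.IsPortfolio τ)
    (hτ1 : PortfolioTheory.IsC1 τ)
    (hne : ∃ p ∈ PortfolioTheory.openSimplex n, τ p ≠ π p) :
    ∃ K : Set (Fin n → ℝ), IsCompact K ∧ K ⊆ PortfolioTheory.openSimplex n ∧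
      ∃ μ : ℕ → Fin n → ℝ, (∀ t, μ t ∈ K) ∧
        (∃ N : ℕ, 0 < N ∧ ∀ t, μ (t + N) = μ t) ∧
        Filter.Tendsto
          (fun t => PortfolioTheory.relativeValue τ μ t / PortfolioTheory.relativeValue π μ t)
          Filter.atTop (nhds 0) := by
  by_contra hcon
  have hcycle : ∀ p ∈ openSimplex n, ∀ q ∈ openSimplex n,
      (1 + excessReturn π p q) * (1 + excessReturn π q p) ≤
        (1 + excessReturn τ p q) * (1 + excessReturn τ q p) := by
    intro p hp q hq
    by_contra! hlt
    exact hcon (exists_periodic_of_two_cycle hp hq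
      (mul_nonneg (one_add_excessReturn_nonneg hτ.mapsTo hp hq)
        (one_add_excessReturn_nonneg hτ.mapsTo hq hp)) hlt)
  obtain ⟨p, hp, hpne⟩ := hne
  have hle : ∀ i ∈ Finset.univ, π p i ≤ τ p i := fun i _ =>
    weight_le_of_two_cycle hn hπ.mapsTo hΦ hgen _ hint hτ.mapsTo hτ1 hcycle hp i
  have hsum : ∑ i, π p i = ∑ i, τ p i := by rw [(hπ.mapsTo hp).2, (hτ.mapsTo hp).2]
  exact hpne (funext fun i => ((Finset.sum_eq_sum_iff_of_le hle).1 hsum i (Finset.mem_univ i)).symm)
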